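/- Let $\xi$ be the Riemann xi function, i.e. the entire function $\xi(s)=\frac12 s(s-1)\pi^{-s/2}\Gamma\left(\frac s2\right)\zeta(s)$ (extended by continuity to the removable singularities $s=1$ and $s=0,-2,-4,\dots$ of the right-hand side), and let $\psi(y)=\sum_{n=1}^{\infty}e^{-\pi n^2y}$ for $y>0$. Then for all $\tau,t\in\mathbb{R}$ the integrals below converge absolutely and $$ \begin{aligned} 4\left|\xi\left(\tfrac12+\tau-it\right)\right|^2 ={}&2\left[\left(t^2+\tau^2+\tfrac14\right)^2-\tau^2\right]\int_0^\infty\int_0^\infty\cos\left(\tfrac t2\ln(uv)\right)u^{\frac{2\tau-3}{4}}v^{\frac{-2\tau-3}{4}}1_{\{uv>1\}}\psi(u)\psi(v)\,du\,dv\\ &-t^2\int_1^\infty\left[(1+2\tau)\left(u^{\tau-\frac12}+u^{-\tau-1}\right)+(1-2\tau)\left(u^{-\tau-\frac12}+u^{\tau-1}\right)\right]\psi(u)\,du\\ &-2\left(\tau^2-\tfrac14\right)^2\int_0^\infty\int_0^\infty u^{\frac{2\tau-3}{4}}v^{\frac{-2\tau-3}{4}}1_{\{uv>1\}}\psi(u)\psi(v)\,du\,dv\\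 &+\left[1+\left(\tau^2-\tfrac14\right)\int_1^\infty\left(u^{\frac{2\tau-3}{4}}+u^{\frac{-2\tau-3}{4}}\right)\psi(u)\,du\right]^2. \end{aligned} $$ -/

import Mathlib

open MeasureTheory Set

noncomputable section

/-- The theta function `ψ(y) = ∑_{n ≥ 1} exp (-π n² y)`, used for `y > 0`. -/
def thetaPsi (y : ℝ) : ℝ := ∑' n : ℕ, Real.exp (-Real.pi * ((n : ℝ) + 1) ^ 2 * y)

/-- The series defining `ψ(y)` converges for every `y > 0`. -/
theorem hasSum_thetaPsi {y : ℝ} (hy : 0 < y) :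
    HasSum (fun n : ℕ => Real.exp (-Real.pi * ((n : ℝ) + 1) ^ 2 * y)) (thetaPsi y) := by
  apply Summable.hasSum
  have h1 : Summable (fun n : ℕ => Real.exp ((n : ℝ) * (-(Real.pi * y)))) := by
    apply Real.summable_exp_nat_mul_iff.mpr
    have := mul_pos Real.pi_pos hy
    linarith
  refine Summable.of_nonneg_of_le (fun n => (Real.exp_pos _).le) (fun n => ?_) h1
  apply Real.exp_le_exp.mpr
  have h2 := mul_pos Real.pi_pos hy
  have h3 : (0 : ℝ) ≤ (n : ℝ) := Nat.cast_nonneg n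
  nlinarith [mul_nonneg h2.le h3, mul_nonneg h2.le (mul_nonneg h3 h3)]

/-- The Riemann xi function, i.e. the entire function which is equal to
`(1/2) s (s - 1) π ^ (-s/2) Γ(s/2) ζ(s)` wherever the factors are defined: see
`riemannXi_eq` for the formula and `differentiable_riemannXi` for holomorphy on all of `ℂ`.
Here `completedRiemannZeta₀ s` is the entire function
`π ^ (-s/2) Γ(s/2) ζ(s) + 1 / s + 1 / (1 - s)`. -/
def riemannXi (s : ℂ) : ℂ := (s * (s - 1) * completedRiemannZeta₀ s + 1) / 2

/-- `ξ` is entire. -/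
theorem differentiable_riemannXi : Differentiable ℂ riemannXi := by
  have h := differentiable_completedZeta₀
  unfold riemannXi
  fun_prop

/-- `ξ` is given by the usual formula away from the (removable) singularities of the latter. -/
theorem riemannXi_eq {s : ℂ} (hs : ∀ n : ℕ, s ≠ -(2 * (n : ℂ))) (hs1 : s ≠ 1) :
    riemannXi s = 1 / 2 * s * (s - 1) * (Real.pi : ℂ) ^ (-s / 2) * Complex.Gamma (s / 2)
      * riemannZeta s := by
  have h0 : s ≠ 0 := by simpa using hs 0
  have h1 : (1 : ℂ) - s ≠ 0 := sub_ne_zero.mpr hs1.symm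
  have hG : Complex.Gammaℝ s ≠ 0 := by
    rw [Ne, Complex.Gammaℝ_eq_zero_iff]
    rintro ⟨n, hn⟩
    exact hs n hn
  have hz : completedRiemannZeta s = Complex.Gammaℝ s * riemannZeta s := by
    rw [riemannZeta_def_of_ne_zero h0]
    field_simp
  have hL := completedRiemannZeta_eq s
  have h2 : completedRiemannZeta₀ s = Complex.Gammaℝ s * riemannZeta s + 1 / s + 1 / (1 - s) := by
    rw [← hz, hL]; ring
  rw [riemannXi, h2, Complex.Gammaℝ_def]
  field_simp
  ring

/-- The weight `u ^ ((2τ-3)/4) v ^ ((-2τ-3)/4) 1_{uv > 1} ψ(u) ψ(v)` of the double integrals. -/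
def thetaWeight (τ u v : ℝ) : ℝ :=
  u ^ ((2 * τ - 3) / 4) * v ^ ((-2 * τ - 3) / 4) * (if 1 < u * v then 1 else 0)
    * thetaPsi u * thetaPsi v

end

open MeasureTheory Set

noncomputable section

/-! Write `g_s(u) = u^(s/2-1) ψ(u)` and `M(s) = ∫_1^∞ g_s`. Riemann's representation is `2ξ(s) = 1 +
s(s-1)(M(s) + M(1-s))`; the task is to expand its squared modulus.

Let `D` be the integral of `g_s(u) g_{1-s̄}(v)` over `uv > 1`. The square `u, v > 1` contributes
`M(s) M(1-s̄)`. On each strip where one variable is at most 1, inverting that variable and applying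
the theta transformation law yields an integral over the triangle `1 < w < u`, plus elementary terms
(`mul_setIntegral_thetaKernel`). The triangle integrals for `(s, s̄)` and `(1-s̄, 1-s)` add up with
their conjugates to `|M(s)|²` and `|M(1-s)|²` (`thetaTriangle_add_swap`). Hence `D + D̄` is `|M(s) +
M(1-s)|²` up to single integrals, which gives `four_mul_riemannXi_mul_conj`.

For `s = 1/2 + τ - it` the remaining values of `M` are at real points independent of `t`.
Subtracting the case `t = 0`, where `ξ` is real, leaves only the `t²` part of the single integrals.
-/

/-! ### The theta function: transformation law and growth at 0. -/

open HurwitzZeta in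
theorem cosKernel_zero_eq {x : ℝ} (hx : 0 < x) : cosKernel 0 x = 1 + 2 * thetaPsi x := by
  have h1 := hasSum_nat_cosKernel₀ 0 hx
  have h2 := (hasSum_thetaPsi hx).mul_left 2
  simp only [mul_zero, zero_mul, Real.cos_zero, mul_one] at h1
  have := h1.unique h2
  rw [QuotientAddGroup.mk_zero] at this
  linarith

theorem continuousOn_thetaPsi : ContinuousOn thetaPsi (Ioi 0) := by
  refine ContinuousOn.congr (f := fun x => (HurwitzZeta.cosKernel 0 x - 1) / 2) ?_ fun x hx => ?_
  · exact ((HurwitzZeta.continuousOn_cosKernel 0).sub continuousOn_const).div_const 2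
  · simp only [cosKernel_zero_eq hx]
    ring

theorem thetaPsi_nonneg (y : ℝ) : 0 ≤ thetaPsi y := tsum_nonneg fun _ => (Real.exp_pos _).le

/-- The transformation law of the theta function. -/
theorem thetaPsi_inv {x : ℝ} (hx : 0 < x) :
    thetaPsi x⁻¹ = x ^ (1 / 2 : ℝ) * thetaPsi x + (x ^ (1 / 2 : ℝ) - 1) / 2 := by
  have h := HurwitzZeta.evenKernel_functional_equation 0 x
  rw [HurwitzZeta.evenKernel_eq_cosKernel_of_zero, cosKernel_zero_eq hx,
    cosKernel_zero_eq (one_div_pos.mpr hx), one_div x] at h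
  have h0 := (Real.rpow_pos_of_pos hx (1 / 2)).ne'
  field_simp at h
  rw [inv_eq_one_div]
  linarith

/-- Termwise `exp (-z) ≤ 1/z`. This is crude, but any power bound near 0 suffices for the strip
estimate. -/
theorem exists_thetaPsi_le : ∃ C : ℝ, 0 ≤ C ∧ ∀ y, 0 < y → thetaPsi y ≤ C * y⁻¹ := by
  have hs : Summable fun n : ℕ => 1 / ((n : ℝ) + 1) ^ 2 := by
    have := (summable_nat_add_iff (f := fun n : ℕ => 1 / (n : ℝ) ^ 2) 1).mpr
      (Real.summable_one_div_nat_pow.mpr one_lt_two)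
    simpa using this
  refine ⟨∑' n : ℕ, 1 / ((n : ℝ) + 1) ^ 2, tsum_nonneg fun n => by positivity, fun y hy => ?_⟩
  rw [← tsum_mul_right]
  refine (hasSum_thetaPsi hy).summable.tsum_le_tsum (fun n => ?_) (hs.mul_right _)
  have hz : 0 < ((n : ℝ) + 1) ^ 2 * y := by positivity
  have h1 : Real.exp (-Real.pi * ((n : ℝ) + 1) ^ 2 * y) ≤ Real.exp (-(((n : ℝ) + 1) ^ 2 * y)) := by
    apply Real.exp_le_exp.mpr
    nlinarith [Real.pi_gt_three]
  refine h1.trans ?_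
  rw [Real.exp_neg, one_div, ← mul_inv]
  exact inv_anti₀ hz (by linarith [Real.add_one_le_exp (((n : ℝ) + 1) ^ 2 * y)])

/-! ### Riemann's representation by incomplete Mellin transforms. -/

theorem integral_Ioo_zero_one_eq_integral_inv (f : ℝ → ℂ) :
    ∫ x in Ioo (0 : ℝ) 1, f x = ∫ x in Ioi (1 : ℝ), ((x : ℂ) ^ 2)⁻¹ * f x⁻¹ := by
  have himg : (fun x : ℝ => x⁻¹) '' Ioi 1 = Ioo 0 1 := by
    rw [image_inv_eq_inv, inv_Ioi₀ one_pos, inv_one]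
  have h := integral_image_eq_integral_abs_deriv_smul (s := Ioi (1 : ℝ)) (f := fun x => x⁻¹)
    (f' := fun x => -(x ^ 2)⁻¹) measurableSet_Ioi
    (fun x hx => (hasDerivAt_inv (zero_lt_one.trans hx).ne').hasDerivWithinAt)
    inv_injective.injOn f
  rw [himg] at h
  rw [h]
  refine setIntegral_congr_fun measurableSet_Ioi fun x _ => ?_
  simp [abs_neg, abs_inv]

/-- The integrand of the Mellin transform of the theta function, at `s / 2`. -/
def thetaTerm (s : ℂ) (u : ℝ) : ℂ := (u : ℂ) ^ (s / 2 - 1) * (thetaPsi u : ℂ)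

/-- The incomplete Mellin transform of the theta function, at `s / 2`. -/
def thetaMellin (s : ℂ) : ℂ := ∫ u in Ioi (1 : ℝ), thetaTerm s u

theorem continuousOn_thetaTerm (s : ℂ) : ContinuousOn (thetaTerm s) (Ioi 0) := by
  refine ContinuousOn.mul (fun x hx => ContinuousAt.continuousWithinAt ?_)
    (Complex.continuous_ofReal.comp_continuousOn continuousOn_thetaPsi)
  exact Complex.continuousAt_ofReal_cpow_const _ _ (Or.inr (ne_of_gt hx))

theorem hurwitzEvenFEPair_f_modif_of_one_lt {x : ℝ} (hx : 1 < x) :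
    (HurwitzZeta.hurwitzEvenFEPair 0).f_modif x = 2 * (thetaPsi x : ℂ) := by
  simp [WeakFEPair.f_modif, HurwitzZeta.hurwitzEvenFEPair, hx, hx.le,
    HurwitzZeta.evenKernel_eq_cosKernel_of_zero, cosKernel_zero_eq (zero_lt_one.trans hx)]

/-- `f_modif` removes the limit at infinity on `(1, ∞)` and the singular term at 0 on `(0, 1)`, so
the functional equation carries one piece to the other with no elementary remainder. -/
theorem hurwitzEvenFEPair_f_modif_inv {x : ℝ} (hx : 1 < x) :
    (HurwitzZeta.hurwitzEvenFEPair 0).f_modif x⁻¹ =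
      2 * (x : ℂ) ^ (1 / 2 : ℂ) * (thetaPsi x : ℂ) := by
  have h0 : 0 < x := zero_lt_one.trans hx
  rw [← one_div, WeakFEPair.hf_modif_FE _ x h0]
  simp [WeakFEPair.g_modif, HurwitzZeta.hurwitzEvenFEPair, hx, hx.le, cosKernel_zero_eq h0,
    Complex.ofReal_cpow h0.le]
  ring

theorem mellinConvergent_hurwitzEvenFEPair_f_modif (s : ℂ) :
    MellinConvergent (HurwitzZeta.hurwitzEvenFEPair 0).f_modif s :=
  ((HurwitzZeta.hurwitzEvenFEPair 0).isStrongFEPair_toStrongFEPair.hasMellin s).1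

theorem integrableOn_thetaTerm (s : ℂ) : IntegrableOn (thetaTerm s) (Ioi 1) := by
  have h := (mellinConvergent_hurwitzEvenFEPair_f_modif (s / 2)).mono_set
    (Ioi_subset_Ioi zero_le_one)
  refine IntegrableOn.congr_fun (Integrable.const_mul h (1 / 2)) (fun x hx => ?_) measurableSet_Ioi
  simp only [hurwitzEvenFEPair_f_modif_of_one_lt hx, smul_eq_mul, thetaTerm]
  ring

theorem completedRiemannZeta₀_eq_thetaMellin (s : ℂ) :
    completedRiemannZeta₀ s = thetaMellin s + thetaMellin (1 - s) := by
  have hc := mellinConvergent_hurwitzEvenFEPair_f_modif (s / 2)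
  -- `completedRiemannZeta₀ s` is by definition half of this Mellin transform at `s / 2`.
  change mellin (HurwitzZeta.hurwitzEvenFEPair 0).f_modif (s / 2) / 2 = _
  have hU : Ioi (0 : ℝ) = Ioc 0 1 ∪ Ioi 1 := (Ioc_union_Ioi_eq_Ioi zero_le_one).symm
  rw [mellin, hU, setIntegral_union Ioc_disjoint_Ioi_same measurableSet_Ioi
    (hc.mono_set Ioc_subset_Ioi_self) (hc.mono_set (Ioi_subset_Ioi zero_le_one)),
    integral_Ioc_eq_integral_Ioo, integral_Ioo_zero_one_eq_integral_inv]
  have h1 : ∫ x in Ioi (1 : ℝ), ((x : ℂ) ^ 2)⁻¹ * (((x⁻¹ : ℝ) : ℂ) ^ (s / 2 - 1) •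
      (HurwitzZeta.hurwitzEvenFEPair 0).f_modif x⁻¹) = 2 * thetaMellin (1 - s) := by
    rw [thetaMellin, ← integral_const_mul]
    refine setIntegral_congr_fun measurableSet_Ioi fun x hx => ?_
    have h0 : 0 < x := zero_lt_one.trans hx
    have h0' : (x : ℂ) ≠ 0 := Complex.ofReal_ne_zero.mpr h0.ne'
    simp only [hurwitzEvenFEPair_f_modif_inv hx, smul_eq_mul, thetaTerm]
    rw [Complex.ofReal_inv, Complex.inv_cpow _ _ (by
      rw [Complex.arg_ofReal_of_nonneg h0.le]; exact Real.pi_pos.ne), ← Complex.cpow_neg,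
      ← Complex.cpow_natCast, ← Complex.cpow_neg]
    have : (x : ℂ) ^ ((1 - s) / 2 - 1) =
        (x : ℂ) ^ (-((2 : ℕ) : ℂ)) * (x : ℂ) ^ (-(s / 2 - 1)) * (x : ℂ) ^ (1 / 2 : ℂ) := by
      rw [← Complex.cpow_add _ _ h0', ← Complex.cpow_add _ _ h0']
      congr 1
      push_cast
      ring
    rw [this]
    ring
  have h2 : ∫ x in Ioi (1 : ℝ), (x : ℂ) ^ (s / 2 - 1) •
      (HurwitzZeta.hurwitzEvenFEPair 0).f_modif x = 2 * thetaMellin s := by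
    rw [thetaMellin, ← integral_const_mul]
    refine setIntegral_congr_fun measurableSet_Ioi fun x hx => ?_
    simp only [hurwitzEvenFEPair_f_modif_of_one_lt hx, smul_eq_mul, thetaTerm]
    ring
  rw [h1, h2]
  ring

/-! ### Inversion of one variable and its elementary remainder. -/

/-- The factor `w⁻²` is the Jacobian of `v = 1/w`; the difference of powers comes from the
inhomogeneous part of the transformation law. -/
theorem inv_sq_mul_thetaTerm_inv (r : ℂ) {w : ℝ} (hw : 0 < w) :
    ((w : ℂ) ^ 2)⁻¹ * thetaTerm r w⁻¹ = thetaTerm (1 - r) w +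
      ((w : ℂ) ^ ((1 - r) / 2 - 1) - (w : ℂ) ^ (((1 - r) - 1) / 2 - 1)) / 2 := by
  have h0' : (w : ℂ) ≠ 0 := Complex.ofReal_ne_zero.mpr hw.ne'
  rw [thetaTerm, thetaTerm, thetaPsi_inv hw, Complex.ofReal_inv, Complex.inv_cpow _ _ (by
      rw [Complex.arg_ofReal_of_nonneg hw.le]; exact Real.pi_pos.ne), ← Complex.cpow_neg,
      ← Complex.cpow_natCast, ← Complex.cpow_neg]
  have h1 : (w : ℂ) ^ ((1 - r) / 2 - 1) =
      (w : ℂ) ^ (-((2 : ℕ) : ℂ)) * (w : ℂ) ^ (-(r / 2 - 1)) * (w : ℂ) ^ (1 / 2 : ℂ) := by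
    rw [← Complex.cpow_add _ _ h0', ← Complex.cpow_add _ _ h0']
    congr 1
    push_cast
    ring
  have h2 : (w : ℂ) ^ (((1 - r) - 1) / 2 - 1) =
      (w : ℂ) ^ (-((2 : ℕ) : ℂ)) * (w : ℂ) ^ (-(r / 2 - 1)) := by
    rw [← Complex.cpow_add _ _ h0']
    congr 1
    push_cast
    ring
  rw [h1, h2]
  push_cast [Complex.ofReal_cpow hw.le]
  ring

/-- An antiderivative free of denominators, valid also at `q = 0` and `q = 1`. -/
theorem mul_integral_cpow_sub_cpow (q : ℂ) {u : ℝ} (hu : 1 ≤ u) :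
    q * (q - 1) * ∫ w in (1 : ℝ)..u, ((w : ℂ) ^ (q / 2 - 1) - (w : ℂ) ^ ((q - 1) / 2 - 1)) / 2 =
      (q - 1) * (u : ℂ) ^ (q / 2) - q * (u : ℂ) ^ ((q - 1) / 2) + 1 := by
  have hd : ∀ (a : ℂ) (w : ℝ), 0 < w →
      HasDerivAt (fun x : ℝ => (x : ℂ) ^ a) (a * (w : ℂ) ^ (a - 1)) w := fun a w hw => by
    rcases eq_or_ne a 0 with rfl | ha
    · simpa using hasDerivAt_const w (1 : ℂ)
    · exact hasDerivAt_ofReal_cpow_const hw.ne' ha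
  have hpos : ∀ w ∈ uIcc 1 u, 0 < w := fun w hw => by
    rw [uIcc_of_le hu] at hw
    exact zero_lt_one.trans_le hw.1
  rw [← intervalIntegral.integral_const_mul]
  rw [intervalIntegral.integral_eq_sub_of_hasDerivAt
    (f := fun x : ℝ => (q - 1) * (x : ℂ) ^ (q / 2) - q * (x : ℂ) ^ ((q - 1) / 2))]
  · simp
  · intro w hw
    have h := ((hd (q / 2) w (hpos w hw)).const_mul (q - 1)).sub
      ((hd ((q - 1) / 2) w (hpos w hw)).const_mul q)
    refine h.congr_deriv ?_
    ring
  · apply ContinuousOn.intervalIntegrable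
    have hc : ∀ a : ℂ, ContinuousOn (fun w : ℝ => (w : ℂ) ^ a) (uIcc 1 u) := fun a w hw =>
      (Complex.continuousAt_ofReal_cpow_const _ _ (Or.inr (hpos w hw).ne')).continuousWithinAt
    exact continuousOn_const.mul (((hc _).sub (hc _)).div_const 2)

/-! ### The double integral over `uv > 1`: integrability and decomposition. -/

/-- The integrand `g_s(u) g_r(v) 1_{uv > 1}`. -/
def thetaKernel (s r : ℂ) : ℝ × ℝ → ℂ :=
  {p : ℝ × ℝ | 1 < p.1 * p.2}.indicator fun p => thetaTerm s p.1 * thetaTerm r p.2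

theorem measurableSet_one_lt_mul : MeasurableSet {p : ℝ × ℝ | 1 < p.1 * p.2} :=
  measurableSet_lt measurable_const (measurable_fst.mul measurable_snd)

theorem measurableSet_snd_lt_fst : MeasurableSet {p : ℝ × ℝ | p.2 < p.1} :=
  measurableSet_lt measurable_snd measurable_fst

theorem thetaKernel_swap (s r : ℂ) (p : ℝ × ℝ) : thetaKernel s r p.swap = thetaKernel r s p := by
  simp [thetaKernel, indicator, mul_comm]

theorem norm_thetaTerm (s : ℂ) {u : ℝ} (hu : 0 < u) :
    ‖thetaTerm s u‖ = u ^ (s.re / 2 - 1) * thetaPsi u := by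
  rw [thetaTerm, norm_mul, Complex.norm_cpow_eq_rpow_re_of_pos hu, Complex.norm_real,
    Real.norm_of_nonneg (thetaPsi_nonneg u)]
  simp

theorem aestronglyMeasurable_thetaTerm (s : ℂ) {A : Set ℝ} (hA : MeasurableSet A)
    (h : A ⊆ Ioi 0) : AEStronglyMeasurable (thetaTerm s) (volume.restrict A) :=
  ((continuousOn_thetaTerm s).mono h).aestronglyMeasurable hA

theorem integrableOn_thetaTerm_mul (s r : ℂ) :
    IntegrableOn (fun p : ℝ × ℝ => thetaTerm s p.1 * thetaTerm r p.2) (Ioi 1 ×ˢ Ioi 1) := by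
  rw [IntegrableOn, Measure.volume_eq_prod, ← Measure.prod_restrict]
  exact Integrable.mul_prod (integrableOn_thetaTerm s) (integrableOn_thetaTerm r)

/-- On the support `1/v < u`, so the blow-up in `v` near 0 is at most a power of `u`, which is
absorbed by shifting the parameter `s`. -/
theorem integrableOn_thetaKernel_Ioi_Ioc (s r : ℂ) :
    IntegrableOn (thetaKernel s r) (Ioi 1 ×ˢ Ioc 0 1) := by
  obtain ⟨C, hC0, hC⟩ := exists_thetaPsi_le
  -- The second `- 1` comes from the bound `ψ(v) ≤ C / v`.
  set N : ℝ := |r.re / 2 - 1 - 1| with hN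
  have hdom : IntegrableOn (fun p : ℝ × ℝ => ‖thetaTerm (s + 2 * N) p.1‖ * C)
      (Ioi 1 ×ˢ Ioc 0 1) := by
    rw [IntegrableOn, Measure.volume_eq_prod, ← Measure.prod_restrict]
    exact Integrable.mul_prod (g := fun _ => C) (integrableOn_thetaTerm _).norm
      (integrableOn_const (by simp))
  refine Integrable.mono' hdom ?_ ?_
  · rw [Measure.volume_eq_prod, ← Measure.prod_restrict]
    refine AEStronglyMeasurable.indicator (AEStronglyMeasurable.mul ?_ ?_) measurableSet_one_lt_mul
    · exact (aestronglyMeasurable_thetaTerm s measurableSet_Ioi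
        (Ioi_subset_Ioi zero_le_one)).comp_fst
    · exact (aestronglyMeasurable_thetaTerm r measurableSet_Ioc Ioc_subset_Ioi_self).comp_snd
  · refine (ae_restrict_iff' (measurableSet_Ioi.prod measurableSet_Ioc)).mpr (ae_of_all _ ?_)
    rintro ⟨u, v⟩ ⟨hu, hv0, hv1⟩
    dsimp only at hu hv0 hv1 ⊢
    have hu0 : 0 < u := zero_lt_one.trans hu
    rw [thetaKernel, indicator_apply]
    split_ifs with huv
    · simp only [mem_ofPred_eq] at huv
      have huv' : v⁻¹ ≤ u := by
        rw [inv_le_iff_one_le_mul₀ hv0]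
        exact huv.le
      rw [norm_mul, norm_thetaTerm s hu0, norm_thetaTerm r hv0, norm_thetaTerm _ hu0]
      have hre : (s + 2 * (N : ℂ)).re / 2 - 1 = s.re / 2 - 1 + N := by
        simp
        ring
      rw [hre, Real.rpow_add hu0]
      have h1 : v ^ (r.re / 2 - 1) * thetaPsi v ≤ u ^ N * C := by
        calc v ^ (r.re / 2 - 1) * thetaPsi v ≤ v ^ (r.re / 2 - 1) * (C * v⁻¹) := by
              gcongr
              exact hC v hv0
          _ = v ^ (r.re / 2 - 1 - 1) * C := by
              rw [Real.rpow_sub_one hv0.ne' (r.re / 2 - 1)]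
              ring
          _ ≤ v ^ (-N) * C := by
              gcongr ?_ * C
              exact Real.rpow_le_rpow_of_exponent_ge hv0 hv1 (neg_abs_le _)
          _ = v⁻¹ ^ N * C := by rw [Real.rpow_neg hv0.le, Real.inv_rpow hv0.le]
          _ ≤ u ^ N * C := by
              gcongr
      have h2 : 0 ≤ u ^ (s.re / 2 - 1) * thetaPsi u :=
        mul_nonneg (Real.rpow_nonneg hu0.le _) (thetaPsi_nonneg u)
      calc _ ≤ u ^ (s.re / 2 - 1) * thetaPsi u * (u ^ N * C) := by gcongr
        _ = _ := by ring
    · rw [norm_zero]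
      positivity

theorem integrableOn_thetaKernel_Ioc_Ioi (s r : ℂ) :
    IntegrableOn (thetaKernel s r) (Ioc 0 1 ×ˢ Ioi 1) := by
  have h := (integrableOn_thetaKernel_Ioi_Ioc r s).swap
  simp only [Function.comp_def, thetaKernel_swap] at h
  exact h

theorem thetaKernel_eqOn_Ioi_Ioi (s r : ℂ) : EqOn (thetaKernel s r)
    (fun p : ℝ × ℝ => thetaTerm s p.1 * thetaTerm r p.2) (Ioi 1 ×ˢ Ioi 1) := fun p hp => by
  have h : p ∈ {p : ℝ × ℝ | 1 < p.1 * p.2} :=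
    one_lt_mul_of_lt_of_le (mem_Ioi.mp hp.1) (mem_Ioi.mp hp.2).le
  rw [thetaKernel, indicator_of_mem h]

theorem thetaKernel_eqOn_Ioc_Ioc (s r : ℂ) : EqOn (thetaKernel s r) (fun _ => 0)
    (Ioc 0 1 ×ˢ Ioc 0 1) := fun p hp => by
  have h : p ∉ {p : ℝ × ℝ | 1 < p.1 * p.2} := fun h =>
    (mem_ofPred.mp h).not_ge (mul_le_one₀ hp.1.2 hp.2.1.le hp.2.2)
  rw [thetaKernel, indicator_of_notMem h]

theorem integrableOn_thetaKernel_Ioi_Ioi (s r : ℂ) :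
    IntegrableOn (thetaKernel s r) (Ioi 1 ×ˢ Ioi 1) :=
  (integrableOn_thetaTerm_mul s r).congr_fun (thetaKernel_eqOn_Ioi_Ioi s r).symm
    (measurableSet_Ioi.prod measurableSet_Ioi)

theorem integrableOn_thetaKernel_Ioc_Ioc (s r : ℂ) :
    IntegrableOn (thetaKernel s r) (Ioc 0 1 ×ˢ Ioc 0 1) :=
  integrableOn_zero.congr_fun (thetaKernel_eqOn_Ioc_Ioc s r).symm
    (measurableSet_Ioc.prod measurableSet_Ioc)

theorem Ioi_zero_eq_union : Ioi (0 : ℝ) = Ioc 0 1 ∪ Ioi 1 :=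
  (Ioc_union_Ioi_eq_Ioi zero_le_one).symm

theorem integrableOn_thetaKernel (s r : ℂ) :
    IntegrableOn (thetaKernel s r) (Ioi 0 ×ˢ Ioi 0) := by
  rw [Ioi_zero_eq_union, union_prod, prod_union, prod_union]
  exact ((integrableOn_thetaKernel_Ioc_Ioc s r).union (integrableOn_thetaKernel_Ioc_Ioi s r)).union
    ((integrableOn_thetaKernel_Ioi_Ioc s r).union (integrableOn_thetaKernel_Ioi_Ioi s r))

theorem setIntegral_thetaKernel (s r : ℂ) :
    ∫ p in Ioi 0 ×ˢ Ioi 0, thetaKernel s r p = thetaMellin s * thetaMellin r +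
      (∫ p in Ioi 1 ×ˢ Ioc 0 1, thetaKernel s r p) +
      ∫ p in Ioi 1 ×ˢ Ioc 0 1, thetaKernel r s p := by
  have hd := Ioc_disjoint_Ioi_same (a := (0 : ℝ)) (b := 1)
  have hoi := measurableSet_Ioi (a := (1 : ℝ))
  have hoc := measurableSet_Ioc (a := (0 : ℝ)) (b := 1)
  have h1 : ∫ p in Ioi 1 ×ˢ Ioi 1, thetaKernel s r p = thetaMellin s * thetaMellin r := by
    rw [setIntegral_congr_fun (hoi.prod hoi) (thetaKernel_eqOn_Ioi_Ioi s r),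
      Measure.volume_eq_prod, setIntegral_prod_mul]
    rfl
  have h2 : ∫ p in Ioc 0 1 ×ˢ Ioc 0 1, thetaKernel s r p = 0 := by
    rw [setIntegral_congr_fun (hoc.prod hoc) (thetaKernel_eqOn_Ioc_Ioc s r), integral_zero]
  have h3 : ∫ p in Ioc 0 1 ×ˢ Ioi 1, thetaKernel s r p =
      ∫ p in Ioi 1 ×ˢ Ioc 0 1, thetaKernel r s p := by
    simp_rw [← thetaKernel_swap s r]
    rw [Measure.volume_eq_prod]
    exact (setIntegral_prod_swap (Ioc 0 1) (Ioi 1) (thetaKernel s r)).symm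
  rw [Ioi_zero_eq_union, union_prod, setIntegral_union (hd.set_prod_left _ _)
    (hoi.prod (hoc.union hoi)), prod_union, prod_union,
    setIntegral_union (hd.set_prod_right _ _) (hoc.prod hoi)
      (integrableOn_thetaKernel_Ioc_Ioc s r) (integrableOn_thetaKernel_Ioc_Ioi s r),
    setIntegral_union (hd.set_prod_right _ _) (hoi.prod hoi)
      (integrableOn_thetaKernel_Ioi_Ioc s r) (integrableOn_thetaKernel_Ioi_Ioi s r), h1, h2, h3]
  · ring
  · rw [prod_union]
    exact (integrableOn_thetaKernel_Ioc_Ioc s r).union (integrableOn_thetaKernel_Ioc_Ioi s r)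
  · rw [prod_union]
    exact (integrableOn_thetaKernel_Ioi_Ioc s r).union (integrableOn_thetaKernel_Ioi_Ioi s r)

/-! ### Triangle integrals and the strips. -/

/-- The integral of `g_s(u) g_q(w)` over the region `1 < w < u`. -/
def thetaTriangle (s q : ℂ) : ℂ :=
  ∫ u in Ioi (1 : ℝ), ∫ w in Ioi (1 : ℝ),
    {p : ℝ × ℝ | p.2 < p.1}.indicator (fun p => thetaTerm s p.1 * thetaTerm q p.2) (u, w)

theorem integrable_thetaTriangle (s q : ℂ) :
    Integrable ({p : ℝ × ℝ | p.2 < p.1}.indicator fun p => thetaTerm s p.1 * thetaTerm q p.2)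
      ((volume.restrict (Ioi 1)).prod (volume.restrict (Ioi 1))) := by
  refine Integrable.indicator ?_ measurableSet_snd_lt_fst
  exact Integrable.mul_prod (integrableOn_thetaTerm s) (integrableOn_thetaTerm q)

/-- The regions `w < u` and `u < w` fill the quadrant `u, w > 1` up to the null diagonal. -/
theorem thetaTriangle_add_swap (s q : ℂ) :
    thetaTriangle s q + thetaTriangle q s = thetaMellin s * thetaMellin q := by
  have h1 : thetaTriangle q s = ∫ u in Ioi (1 : ℝ), ∫ w in Ioi (1 : ℝ),
      {p : ℝ × ℝ | p.2 < p.1}.indicator (fun p => thetaTerm q p.1 * thetaTerm s p.2) (w, u) :=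
    integral_integral_swap (f := fun u w => {p : ℝ × ℝ | p.2 < p.1}.indicator
      (fun p => thetaTerm q p.1 * thetaTerm s p.2) (u, w)) (integrable_thetaTriangle q s)
  rw [h1, thetaTriangle, ← integral_add (integrable_thetaTriangle s q).integral_prod_left
    (integrable_thetaTriangle q s).integral_prod_right, thetaMellin, thetaMellin,
    ← integral_mul_const]
  refine setIntegral_congr_fun measurableSet_Ioi fun u hu => ?_
  have hi := (integrableOn_thetaTerm q).const_mul (thetaTerm s u)
  have e1 : (fun w => {p : ℝ × ℝ | p.2 < p.1}.indicator
      (fun p => thetaTerm s p.1 * thetaTerm q p.2) (u, w)) =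
      (Iio u).indicator fun w => thetaTerm s u * thetaTerm q w := by
    ext w
    simp [indicator]
  have e2 : (fun w => {p : ℝ × ℝ | p.2 < p.1}.indicator
      (fun p => thetaTerm q p.1 * thetaTerm s p.2) (w, u)) =
      (Ioi u).indicator fun w => thetaTerm s u * thetaTerm q w := by
    ext w
    simp [indicator, mul_comm]
  rw [e1, e2, ← integral_add (hi.indicator measurableSet_Iio) (hi.indicator measurableSet_Ioi),
    ← integral_const_mul]
  refine integral_congr_ae ?_
  have hne : ∀ᵐ w ∂(volume.restrict (Ioi (1 : ℝ))), w ≠ u :=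
    ae_restrict_of_ae (Measure.ae_ne volume u)
  filter_upwards [hne] with w hw
  rcases lt_or_gt_of_ne hw with h | h
  · simp [h, h.le]
  · simp [h, h.le]

theorem integral_Ioc_thetaKernel (s r : ℂ) {u : ℝ} (hu : 1 < u) :
    ∫ v in Ioc (0 : ℝ) 1, thetaKernel s r (u, v) =
      (∫ w in Ioi (1 : ℝ), {p : ℝ × ℝ | p.2 < p.1}.indicator
        (fun p => thetaTerm s p.1 * thetaTerm (1 - r) p.2) (u, w)) +
      thetaTerm s u * ∫ w in (1 : ℝ)..u,
        ((w : ℂ) ^ ((1 - r) / 2 - 1) - (w : ℂ) ^ (((1 - r) - 1) / 2 - 1)) / 2 := by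
  rw [integral_Ioc_eq_integral_Ioo, integral_Ioo_zero_one_eq_integral_inv,
    intervalIntegral.integral_of_le hu.le, integral_Ioc_eq_integral_Ioo]
  have hset : Ioo 1 u = Ioi 1 ∩ Iio u := rfl
  have hc : ∀ a : ℂ, ContinuousOn (fun w : ℝ => (w : ℂ) ^ a) (Icc 1 u) := fun a w hw =>
    (Complex.continuousAt_ofReal_cpow_const _ _
      (Or.inr (zero_lt_one.trans_le hw.1).ne')).continuousWithinAt
  rw [hset, ← setIntegral_indicator measurableSet_Iio, ← integral_const_mul, ← integral_add]
  · refine setIntegral_congr_fun measurableSet_Ioi fun w hw => ?_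
    have hw0 : 0 < w := zero_lt_one.trans hw
    have hiff : 1 < u * w⁻¹ ↔ w < u := by rw [← div_eq_mul_inv, one_lt_div hw0]
    simp only [thetaKernel, indicator, mem_ofPred_eq, hiff, mem_Iio]
    split_ifs
    · rw [mul_left_comm, inv_sq_mul_thetaTerm_inv r hw0]
      ring
    · simp
  · refine Integrable.congr (((integrableOn_thetaTerm (1 - r)).const_mul
      (thetaTerm s u)).indicator (measurableSet_Iio (a := u))) (ae_of_all _ fun w => ?_)
    simp [indicator]
  · refine Integrable.const_mul ?_ _
    rw [integrable_indicator_iff measurableSet_Iio, IntegrableOn,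
      Measure.restrict_restrict measurableSet_Iio, inter_comm, ← hset]
    exact ((((hc _).sub (hc _)).div_const 2).integrableOn_Icc).mono_set Ioo_subset_Icc_self

theorem thetaTerm_mul_cpow (s a : ℂ) {u : ℝ} (hu : 0 < u) :
    thetaTerm s u * (u : ℂ) ^ (a / 2) = thetaTerm (s + a) u := by
  have h0' : (u : ℂ) ≠ 0 := Complex.ofReal_ne_zero.mpr hu.ne'
  have : (s + a) / 2 - 1 = (s / 2 - 1) + a / 2 := by ring
  rw [thetaTerm, thetaTerm, this, Complex.cpow_add _ _ h0']
  ring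

/-- Inverting `v` turns the strip into the triangle; the elementary remainder, integrated in `w`
from 1 to `u`, shifts the exponent of `g_s(u)`. The factor `q(q-1)` clears the denominators, so no
value of `q` is exceptional. -/
theorem mul_setIntegral_thetaKernel (s r q : ℂ) (hq : q = 1 - r) :
    q * (q - 1) * ∫ p in Ioi 1 ×ˢ Ioc 0 1, thetaKernel s r p =
      q * (q - 1) * thetaTriangle s q + (q - 1) * thetaMellin (s + q)
        - q * thetaMellin (s + q - 1) + thetaMellin s := by
  have hint := integrableOn_thetaKernel_Ioi_Ioc s r
  rw [Measure.volume_eq_prod, setIntegral_prod _ hint, ← integral_const_mul, thetaTriangle,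
    ← integral_const_mul, thetaMellin, thetaMellin, thetaMellin,
    ← integral_const_mul, ← integral_const_mul]
  have i1 := (integrable_thetaTriangle s q).integral_prod_left.const_mul (q * (q - 1))
  have i2 := (integrableOn_thetaTerm (s + q)).const_mul (q - 1)
  have i3 := (integrableOn_thetaTerm (s + q - 1)).const_mul q
  have i12 := i1.add i2
  simp only [Pi.add_def] at i12
  have i123 := i12.sub i3
  simp only [Pi.sub_def] at i123
  rw [← integral_add i1 i2, ← integral_sub i12 i3,
    ← integral_add i123 (integrableOn_thetaTerm s)]
  refine setIntegral_congr_fun measurableSet_Ioi fun u hu => ?_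
  have hu0 : 0 < u := zero_lt_one.trans hu
  rw [integral_Ioc_thetaKernel s r hu, ← hq, mul_add, mul_left_comm _ (thetaTerm s u),
    mul_integral_cpow_sub_cpow q (le_of_lt hu), add_sub_assoc s q 1, ← thetaTerm_mul_cpow s q hu0,
    ← thetaTerm_mul_cpow s (q - 1) hu0]
  ring

/-! ### Conjugation symmetry and the squared modulus of `ξ`. -/

open scoped ComplexConjugate

theorem thetaTerm_conj (s : ℂ) {u : ℝ} (hu : 0 < u) :
    thetaTerm (conj s) u = conj (thetaTerm s u) := by
  have harg : (u : ℂ).arg ≠ Real.pi := by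
    rw [Complex.arg_ofReal_of_nonneg hu.le]
    exact Real.pi_pos.ne
  have h := Complex.cpow_conj (u : ℂ) (s / 2 - 1) harg
  rw [Complex.conj_ofReal] at h
  have he : conj (s / 2 - 1) = conj s / 2 - 1 := by simp only [map_sub, map_div₀, map_ofNat, map_one]
  rw [thetaTerm, thetaTerm, map_mul, Complex.conj_ofReal, ← h, he]

theorem thetaMellin_conj (s : ℂ) : thetaMellin (conj s) = conj (thetaMellin s) := by
  rw [thetaMellin, thetaMellin, ← integral_conj]
  exact setIntegral_congr_fun measurableSet_Ioi fun u hu => thetaTerm_conj s (zero_lt_one.trans hu)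

theorem thetaTriangle_conj (s q : ℂ) :
    thetaTriangle (conj s) (conj q) = conj (thetaTriangle s q) := by
  rw [thetaTriangle, thetaTriangle, ← integral_conj]
  refine setIntegral_congr_fun measurableSet_Ioi fun u hu => ?_
  rw [← integral_conj]
  refine setIntegral_congr_fun measurableSet_Ioi fun w hw => ?_
  simp only [indicator_apply]
  split_ifs
  · rw [thetaTerm_conj s (zero_lt_one.trans hu), thetaTerm_conj q (zero_lt_one.trans hw), map_mul]
  · simp

/-- The truncated double Mellin integral of `ψ(u) ψ(v)` over `uv > 1`. -/
def thetaDouble (s r : ℂ) : ℂ := ∫ p in Ioi 0 ×ˢ Ioi 0, thetaKernel s r p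

theorem two_mul_riemannXi_eq (s : ℂ) :
    2 * riemannXi s = 1 + s * (s - 1) * (thetaMellin s + thetaMellin (1 - s)) := by
  rw [riemannXi, completedRiemannZeta₀_eq_thetaMellin]
  ring

theorem four_mul_riemannXi_mul_conj (s : ℂ) :
    4 * (riemannXi s * conj (riemannXi s)) = 1 + s * (s - 1) * (conj s * (conj s - 1)) *
        (thetaDouble s (1 - conj s) + conj (thetaDouble s (1 - conj s)))
      - (s + conj s) * ((s - 1) * (conj s - 1)) *
        (thetaMellin (s + conj s) + thetaMellin (1 - (s + conj s)))
      + (s + conj s - 2) * (s * conj s) *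
        (thetaMellin (s + conj s - 1) + thetaMellin (2 - (s + conj s))) := by
  have hX := two_mul_riemannXi_eq s
  have hX' := congrArg conj hX
  have hI := setIntegral_thetaKernel s (1 - conj s)
  have hI' := congrArg conj hI
  -- Taking `r = 1 - s̄` makes the triangle parameters `s, s̄` conjugate to each other; on the other
  -- strip they are `1 - s̄, 1 - s`, so both triangles symmetrize under conjugation.
  have h1 := mul_setIntegral_thetaKernel s (1 - conj s) (conj s) (by ring)
  have h1' := congrArg conj h1
  have h2 := mul_setIntegral_thetaKernel (1 - conj s) s (1 - s) rfl
  have h2' := congrArg conj h2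
  have hT1 := thetaTriangle_add_swap s (conj s)
  have hT2 := thetaTriangle_add_swap (1 - conj s) (1 - s)
  have c1 := thetaTriangle_conj s (conj s)
  have c2 := thetaTriangle_conj (1 - conj s) (1 - s)
  have m1 := thetaMellin_conj s
  have m2 := thetaMellin_conj (1 - s)
  have m3 := thetaMellin_conj (s + conj s)
  have m4 := thetaMellin_conj (s + conj s - 1)
  have m5 := thetaMellin_conj (2 - (s + conj s))
  have m6 := thetaMellin_conj (1 - (s + conj s))
  have e1 : 1 - conj s + (1 - s) = 2 - (s + conj s) := by ring
  have e2 : 2 - (s + conj s) - 1 = 1 - (s + conj s) := by ring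
  rw [e1, e2] at h2 h2'
  simp only [map_add, map_mul, map_sub, map_one, map_ofNat, Complex.conj_conj, add_comm (conj s) s]
    at hX' hI' h1' h2' c1 c2 m1 m2 m3 m4 m5 m6
  rw [c1, m1] at hT1
  rw [c2, m2] at hT2
  rw [← m3, ← m4] at h1'
  rw [← m5, ← m6] at h2'
  rw [m2] at h2 hI
  simp only [m2, Complex.conj_conj] at hI' h2'
  change thetaDouble s (1 - conj s) = _ at hI
  change conj (thetaDouble s (1 - conj s)) = _ at hI'
  rw [hI', hI]
  -- The strip identities are multiplied by the missing half of `|s(s-1)|²`; their unshifted terms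
  -- in `M(s)`, `M(1-s)` and conjugates match the linear terms of the expanded square.
  linear_combination 2 * conj (riemannXi s) * hX
    + (1 + s * (s - 1) * (thetaMellin s + thetaMellin (1 - s))) * hX'
    - s * (s - 1) * (h1 + h2') - conj s * (conj s - 1) * (h1' + h2)
    - s * (s - 1) * (conj s * (conj s - 1)) * (hT1 + hT2)

/-! ### Passage to real integrals and specialization to `s = 1/2 + τ - it`. -/

theorem thetaTerm_ofReal (x : ℝ) {u : ℝ} (hu : 0 < u) :
    thetaTerm x u = ((u ^ (x / 2 - 1) * thetaPsi u : ℝ) : ℂ) := by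
  rw [thetaTerm]
  push_cast [Complex.ofReal_cpow hu.le]
  rfl

theorem integrableOn_rpow_mul_thetaPsi (a : ℝ) :
    IntegrableOn (fun u => u ^ a * thetaPsi u) (Ioi 1) := by
  refine IntegrableOn.congr_fun (integrableOn_thetaTerm ((2 * a + 2 : ℝ) : ℂ)).re
    (fun u hu => ?_) measurableSet_Ioi
  have : (2 * a + 2) / 2 - 1 = a := by ring
  rw [thetaTerm_ofReal _ (zero_lt_one.trans hu), this]
  rfl

theorem thetaMellin_ofReal (x : ℝ) :
    thetaMellin x = ((∫ u in Ioi (1 : ℝ), u ^ (x / 2 - 1) * thetaPsi u : ℝ) : ℂ) := by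
  rw [thetaMellin, ← integral_complex_ofReal]
  exact setIntegral_congr_fun measurableSet_Ioi fun u hu =>
    thetaTerm_ofReal x (zero_lt_one.trans hu)

/-- `s` and `1 - s̄` have the same imaginary part `-t`, so the two phases combine into
`(uv)^(-it/2)`. -/
theorem re_thetaKernel (τ t : ℝ) {u v : ℝ} (hu : 0 < u) (hv : 0 < v) :
    (thetaKernel (1 / 2 + τ - Complex.I * t) (1 - conj (1 / 2 + τ - Complex.I * t)) (u, v)).re =
      Real.cos (t / 2 * Real.log (u * v)) * thetaWeight τ u v := by
  have hpow : ∀ (a : ℝ) (z : ℂ) (w : ℝ), 0 < w → z = a - t / 2 * Complex.I →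
      (w : ℂ) ^ z = (w ^ a : ℝ) * Complex.exp (((-(t / 2 * Real.log w) : ℝ) : ℂ) * Complex.I) := by
    rintro a _ w hw rfl
    have hw' : (w : ℂ) ≠ 0 := Complex.ofReal_ne_zero.mpr hw.ne'
    rw [Complex.cpow_sub _ _ hw', Complex.ofReal_cpow hw.le, div_eq_mul_inv, ← Complex.cpow_neg,
      Complex.cpow_def_of_ne_zero hw' (-_), ← Complex.ofReal_log hw.le]
    congr 2
    push_cast
    ring
  have e1 : ((1 / 2 + τ - Complex.I * t) / 2 - 1 : ℂ) =
      ((2 * τ - 3) / 4 : ℝ) - t / 2 * Complex.I := by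
    push_cast
    ring
  have e2 : ((1 - conj (1 / 2 + τ - Complex.I * t : ℂ)) / 2 - 1 : ℂ) =
      ((-2 * τ - 3) / 4 : ℝ) - t / 2 * Complex.I := by
    simp only [map_add, map_sub, map_mul, map_div₀, map_one, map_ofNat, Complex.conj_I,
      Complex.conj_ofReal]
    push_cast
    ring
  rw [thetaKernel, indicator_apply, thetaWeight]
  simp only [mem_ofPred_eq]
  split_ifs with h
  · rw [thetaTerm, thetaTerm, hpow _ _ u hu e1, hpow _ _ v hv e2]
    have : ∀ a b c d x y : ℝ, ((a : ℂ) * Complex.exp ((x : ℂ) * Complex.I) * c *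
        ((b : ℂ) * Complex.exp ((y : ℂ) * Complex.I) * d)) =
        ((a * b * c * d : ℝ) : ℂ) * Complex.exp (((x + y : ℝ) : ℂ) * Complex.I) := by
      intros
      push_cast
      rw [add_mul, Complex.exp_add]
      ring
    rw [this, Complex.re_ofReal_mul, Complex.exp_ofReal_mul_I_re, Real.log_mul hu.ne' hv.ne',
      ← neg_add, ← mul_add, Real.cos_neg]
    ring
  · simp

theorem integrableOn_cos_mul_thetaWeight (τ t : ℝ) :
    IntegrableOn (fun p : ℝ × ℝ => Real.cos (t / 2 * Real.log (p.1 * p.2)) * thetaWeight τ p.1 p.2)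
      (Ioi 0 ×ˢ Ioi 0) :=
  IntegrableOn.congr_fun (integrableOn_thetaKernel (1 / 2 + τ - Complex.I * t)
    (1 - conj (1 / 2 + τ - Complex.I * t))).re (fun _ hp => re_thetaKernel τ t hp.1 hp.2)
    (measurableSet_Ioi.prod measurableSet_Ioi)

theorem integrableOn_thetaWeight (τ : ℝ) :
    IntegrableOn (fun p : ℝ × ℝ => thetaWeight τ p.1 p.2) (Ioi 0 ×ˢ Ioi 0) := by
  simpa using integrableOn_cos_mul_thetaWeight τ 0

theorem re_thetaDouble (τ t : ℝ) :
    (thetaDouble (1 / 2 + τ - Complex.I * t) (1 - conj (1 / 2 + τ - Complex.I * t))).re =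
      ∫ v in Ioi (0 : ℝ), ∫ u in Ioi (0 : ℝ),
        Real.cos (t / 2 * Real.log (u * v)) * thetaWeight τ u v := by
  have hi := integrableOn_cos_mul_thetaWeight τ t
  have h := integral_re (𝕜 := ℂ) (integrableOn_thetaKernel (1 / 2 + τ - Complex.I * t)
    (1 - conj (1 / 2 + τ - Complex.I * t)))
  refine h.symm.trans ?_
  refine (setIntegral_congr_fun (measurableSet_Ioi.prod measurableSet_Ioi)
    fun _ hp => re_thetaKernel τ t hp.1 hp.2).trans ?_
  rw [IntegrableOn, Measure.volume_eq_prod, ← Measure.prod_restrict] at hi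
  rw [Measure.volume_eq_prod, ← Measure.prod_restrict]
  exact integral_prod_symm _ hi

theorem four_mul_norm_riemannXi_sq (τ t : ℝ) :
    4 * ‖riemannXi (1 / 2 + (τ : ℂ) - Complex.I * (t : ℂ))‖ ^ 2 =
      1 + 2 * ((t ^ 2 + τ ^ 2 + 1 / 4) ^ 2 - τ ^ 2)
          * (∫ v in Ioi (0 : ℝ), ∫ u in Ioi (0 : ℝ),
              Real.cos (t / 2 * Real.log (u * v)) * thetaWeight τ u v)
        - (1 + 2 * τ) * ((τ - 1 / 2) ^ 2 + t ^ 2) *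
          ((∫ u in Ioi (1 : ℝ), u ^ (τ - 1 / 2) * thetaPsi u) +
            ∫ u in Ioi (1 : ℝ), u ^ (-τ - 1) * thetaPsi u)
        - (1 - 2 * τ) * ((τ + 1 / 2) ^ 2 + t ^ 2) *
          ((∫ u in Ioi (1 : ℝ), u ^ (τ - 1) * thetaPsi u) +
            ∫ u in Ioi (1 : ℝ), u ^ (-τ - 1 / 2) * thetaPsi u) := by
  have h := four_mul_riemannXi_mul_conj (1 / 2 + τ - Complex.I * t)
  rw [Complex.mul_conj, Complex.add_conj, re_thetaDouble, Complex.normSq_eq_norm_sq] at h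
  have hs : conj (1 / 2 + τ - Complex.I * t : ℂ) = 1 / 2 + τ + Complex.I * t := by
    simp only [map_add, map_sub, map_mul, map_div₀, map_one, map_ofNat, Complex.conj_I,
      Complex.conj_ofReal]
    ring
  have a1 : (1 / 2 + τ - Complex.I * t + (1 / 2 + τ + Complex.I * t) : ℂ) =
    ((1 + 2 * τ : ℝ) : ℂ) := by push_cast; ring
  have a2 : (1 - ((1 + 2 * τ : ℝ) : ℂ)) = ((-2 * τ : ℝ) : ℂ) := by push_cast; ring
  have a3 : (((1 + 2 * τ : ℝ) : ℂ) - 1) = ((2 * τ : ℝ) : ℂ) := by push_cast; ring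
  have a4 : (2 - ((1 + 2 * τ : ℝ) : ℂ)) = ((1 - 2 * τ : ℝ) : ℂ) := by push_cast; ring
  rw [hs, a1, a2, a3, a4] at h
  simp only [thetaMellin_ofReal] at h
  have b1 : (1 + 2 * τ) / 2 - 1 = τ - 1 / 2 := by ring
  have b2 : -2 * τ / 2 - 1 = -τ - 1 := by ring
  have b3 : 2 * τ / 2 - 1 = τ - 1 := by ring
  have b4 : (1 - 2 * τ) / 2 - 1 = -τ - 1 / 2 := by ring
  rw [b1, b2, b3, b4] at h
  rw [← Complex.ofReal_inj]
  push_cast at h ⊢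
  rw [h]
  ring_nf
  simp only [Complex.I_sq, Complex.I_pow_four]
  ring

theorem two_mul_riemannXi_real (τ : ℝ) :
    2 * riemannXi (1 / 2 + (τ : ℂ)) = ((1 + (τ ^ 2 - 1 / 4) * (∫ u in Ioi (1 : ℝ),
      (u ^ ((2 * τ - 3) / 4) + u ^ ((-2 * τ - 3) / 4)) * thetaPsi u) : ℝ) : ℂ) := by
  have a1 : (1 / 2 + τ : ℂ) = ((1 / 2 + τ : ℝ) : ℂ) := by push_cast; ring
  have a2 : (1 - ((1 / 2 + τ : ℝ) : ℂ)) = ((1 / 2 - τ : ℝ) : ℂ) := by push_cast; ring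
  have b1 : (1 / 2 + τ) / 2 - 1 = (2 * τ - 3) / 4 := by ring
  have b2 : (1 / 2 - τ) / 2 - 1 = (-2 * τ - 3) / 4 := by ring
  simp only [add_mul]
  rw [integral_add (integrableOn_rpow_mul_thetaPsi _) (integrableOn_rpow_mul_thetaPsi _),
    two_mul_riemannXi_eq, a1, a2, thetaMellin_ofReal, thetaMellin_ofReal, b1, b2]
  push_cast
  ring

end

theorem theorem1 (τ t : ℝ) :
    -- absolute convergence of all the integrals in the formula
    IntegrableOn (fun p : ℝ × ℝ => Real.cos (t / 2 * Real.log (p.1 * p.2)) * thetaWeight τ p.1 p.2)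
      (Ioi 0 ×ˢ Ioi 0) ∧
    IntegrableOn (fun p : ℝ × ℝ => thetaWeight τ p.1 p.2) (Ioi 0 ×ˢ Ioi 0) ∧
    IntegrableOn (fun u : ℝ =>
      ((1 + 2 * τ) * (u ^ (τ - 1 / 2) + u ^ (-τ - 1))
        + (1 - 2 * τ) * (u ^ (-τ - 1 / 2) + u ^ (τ - 1))) * thetaPsi u) (Ioi 1) ∧
    IntegrableOn (fun u : ℝ =>
      (u ^ ((2 * τ - 3) / 4) + u ^ ((-2 * τ - 3) / 4)) * thetaPsi u) (Ioi 1) ∧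
    -- the formula
    4 * ‖riemannXi (1 / 2 + (τ : ℂ) - Complex.I * (t : ℂ))‖ ^ 2 =
      2 * ((t ^ 2 + τ ^ 2 + 1 / 4) ^ 2 - τ ^ 2)
          * (∫ v in Ioi (0 : ℝ), ∫ u in Ioi (0 : ℝ),
              Real.cos (t / 2 * Real.log (u * v)) * thetaWeight τ u v)
        - t ^ 2 * (∫ u in Ioi (1 : ℝ),
            ((1 + 2 * τ) * (u ^ (τ - 1 / 2) + u ^ (-τ - 1))
              + (1 - 2 * τ) * (u ^ (-τ - 1 / 2) + u ^ (τ - 1))) * thetaPsi u)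
        - 2 * (τ ^ 2 - 1 / 4) ^ 2
          * (∫ v in Ioi (0 : ℝ), ∫ u in Ioi (0 : ℝ), thetaWeight τ u v)
        + (1 + (τ ^ 2 - 1 / 4)
            * (∫ u in Ioi (1 : ℝ),
                (u ^ ((2 * τ - 3) / 4) + u ^ ((-2 * τ - 3) / 4)) * thetaPsi u)) ^ 2 := by
  have hadd : ∀ a b : ℝ, IntegrableOn (fun u => u ^ a * thetaPsi u + u ^ b * thetaPsi u) (Ioi 1) :=
    fun a b => (integrableOn_rpow_mul_thetaPsi a).add (integrableOn_rpow_mul_thetaPsi b)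
  have hJ : ∫ u in Ioi (1 : ℝ), ((1 + 2 * τ) * (u ^ (τ - 1 / 2) + u ^ (-τ - 1))
      + (1 - 2 * τ) * (u ^ (-τ - 1 / 2) + u ^ (τ - 1))) * thetaPsi u =
      (1 + 2 * τ) * ((∫ u in Ioi (1 : ℝ), u ^ (τ - 1 / 2) * thetaPsi u) +
          ∫ u in Ioi (1 : ℝ), u ^ (-τ - 1) * thetaPsi u) +
        (1 - 2 * τ) * ((∫ u in Ioi (1 : ℝ), u ^ (-τ - 1 / 2) * thetaPsi u) +
          ∫ u in Ioi (1 : ℝ), u ^ (τ - 1) * thetaPsi u) := by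
    rw [← integral_add (integrableOn_rpow_mul_thetaPsi _) (integrableOn_rpow_mul_thetaPsi _),
      ← integral_add (integrableOn_rpow_mul_thetaPsi _) (integrableOn_rpow_mul_thetaPsi _),
      ← integral_const_mul, ← integral_const_mul, ← integral_add
        ((hadd _ _).const_mul _)
        ((hadd _ _).const_mul _)]
    refine setIntegral_congr_fun measurableSet_Ioi fun u _ => ?_
    ring
  refine ⟨integrableOn_cos_mul_thetaWeight τ t, integrableOn_thetaWeight τ, ?_, ?_, ?_⟩
  · refine IntegrableOn.congr_fun (((hadd (τ - 1 / 2) (-τ - 1)).const_mul (1 + 2 * τ)).add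
      ((hadd (-τ - 1 / 2) (τ - 1)).const_mul (1 - 2 * τ))) (fun u _ => ?_) measurableSet_Ioi
    simp only [Pi.add_apply]
    ring
  · simp only [add_mul]
    exact hadd _ _
  -- At `t = 0` the left side is the square `hr`, and the double integral has coefficient `2(τ² -
  -- 1/4)²`. Subtracting this case cancels the `t`-independent single integrals.
  · have h0 := four_mul_norm_riemannXi_sq τ 0
    have hr : 4 * ‖riemannXi (1 / 2 + (τ : ℂ))‖ ^ 2 = (1 + (τ ^ 2 - 1 / 4) * (∫ u in Ioi (1 : ℝ),
        (u ^ ((2 * τ - 3) / 4) + u ^ ((-2 * τ - 3) / 4)) * thetaPsi u)) ^ 2 := by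
      have h := congrArg norm (two_mul_riemannXi_real τ)
      rw [Complex.norm_real, norm_mul, Complex.norm_ofNat, Real.norm_eq_abs] at h
      rw [← sq_abs (1 + _), ← h]
      ring
    simp only [Complex.ofReal_zero, mul_zero, sub_zero, zero_div, zero_mul, Real.cos_zero,
      one_mul] at h0
    rw [four_mul_norm_riemannXi_sq τ t, hJ, ← hr, h0]
    ring
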